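/- All posets are partially ordered sets; a poset $P$ is an interval order if it is isomorphic to a set of nonempty intervals (order-convex subsets) of some chain $C$, ordered by $I<J$ iff $x<y$ for all $x\in I$, $y\in J$. Let $IO^{<\omega}$ be the class of interval orders with no infinite antichain. For a poset $Q$ with $|Q|\ge 2$ and nonempty posets $P_i$ ($i\in Q$), the lexicographical sum $\sum_{i\in Q}P_i$ is the disjoint union of the $P_i$, ordered by $x\le y$ iff either $x,y\in P_i$ for some $i$ and $x\le y$ in $P_i$, or $x\in P_i$, $y\in P_j$ with $i<j$ in $Q$. A module of $Q$ is a set $A\subseteq Q$ such that, for all $a,a'\in A$ and $x\in Q\setminus A$, $x\le a\Leftrightarrow x\le a'$ and $a\le x\Leftrightarrow a'\le x$; $Q$ is prime if its only modules are $\varnothing$, the singletons and $Q$. An element $i\in Q$ is singular if the set of elements of $Q$ incomparable to $i$ is an antichain. Theorem. Let $P$ be a poset with at least two elements. Then $P\in IO^{<\omega}$ if and only if $P$ is (isomorphic to) a lexicographical sum $\sum_{i\in Q}P_i$, over a poset $Q$ with $|Q|\ge 2$ and with nonempty components, such that each $P_i\in IO^{<\omega}$ and $Q$ is either (1) a chain;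 or (2) a finite antichain, in which case all the $P_i$ but at most one are finite antichains; or (3) a prime element of $IO^{<\omega}$ that is not an antichain, and $P_i$ is a finite antichain for each non-singular $i\in Q$. -/

import Mathlib

universe u

/-- `P` is an interval order: it is isomorphic to a set of nonempty intervals (order-convex subsets)
of some chain `C`, where `I < J` means that every element of `I` is below every element of `J`. -/
def IsIntervalOrder (P : Type u) [PartialOrder P] : Prop :=
  ∃ (C : Type u) (_ : LinearOrder C) (φ : P → Set C),
    Function.Injective φ ∧
    (∀ x, (φ x).Nonempty ∧ (φ x).OrdConnected) ∧
    ∀ x y, x < y ↔ ∀ a ∈ φ x, ∀ b ∈ φ y, a < b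

/-- The class of interval orders without infinite antichains. -/
def IsIOFin (P : Type u) [PartialOrder P] : Prop :=
  IsIntervalOrder P ∧ ∀ s : Set P, IsAntichain (· ≤ ·) s → s.Finite

/-- The poset `P` is a chain. -/
def IsChainPoset (P : Type u) [PartialOrder P] : Prop :=
  ∀ x y : P, x ≤ y ∨ y ≤ x

/-- The poset `P` is an antichain. -/
def IsAntichainPoset (P : Type u) [PartialOrder P] : Prop :=
  ∀ x y : P, x ≤ y → x = y

/-- The poset `P` is a finite antichain. -/
def IsFiniteAntichainPoset (P : Type u) [PartialOrder P] : Prop :=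
  Finite P ∧ IsAntichainPoset P

/-- `A` is a module of the poset `P`: no element outside `A` distinguishes two elements of `A`. -/
def IsPosetModule {P : Type u} [PartialOrder P] (A : Set P) : Prop :=
  ∀ a ∈ A, ∀ a' ∈ A, ∀ x ∉ A, (x ≤ a ↔ x ≤ a') ∧ (a ≤ x ↔ a' ≤ x)

/-- `P` is prime: its only modules are the empty set, the singletons and the whole set. -/
def IsPrimePoset (P : Type u) [PartialOrder P] : Prop :=
  ∀ A : Set P, IsPosetModule A → A = ∅ ∨ (∃ x, A = {x}) ∨ A = Set.univ

/-- `x` is singular: the elements incomparable to `x` form an antichain. -/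
def IsSingular {P : Type u} [PartialOrder P] (x : P) : Prop :=
  IsAntichain (· ≤ ·) {y : P | ¬ x ≤ y ∧ ¬ y ≤ x}

/-! By Fishburn's theorem (`isIntervalOrder_iff_twoPlusTwoFree`), interval orders are exactly the
posets omitting `2 ⊕ 2`; both directions of the theorem use this criterion. For the decomposition, a
series or parallel cut of `P` gives a sum over two elements. If there is no cut, the maximal proper
modules partition `P` as in Gallai's decomposition, and the quotient is prime. Their existence
(`properModuleHull_ne_univ`) is the crux: a strictly growing sequence of proper modules exhausting
too much would produce an infinite antichain. The conditions on components hold because two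
incomparable comparable pairs form a `2 ⊕ 2`. Conversely, a `2 ⊕ 2` in a sum must have a pair inside
one component unless it projects to one in `Q`; `IsPrimePoset.not_isSingular` settles the prime
case. -/

/-! ### Interval orders as `2 ⊕ 2`-free posets. -/

/-- No two comparable pairs are mutually incomparable: the poset omits `2 ⊕ 2`. -/
def TwoPlusTwoFree (P : Type u) [PartialOrder P] : Prop :=
  ∀ x y x' y' : P, x < y → x' < y' → x < y' ∨ x' < y

theorem IsIntervalOrder.twoPlusTwoFree {P : Type u} [PartialOrder P] (h : IsIntervalOrder P) :
    TwoPlusTwoFree P := by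
  obtain ⟨C, _, φ, -, -, hφ⟩ := h
  intro x y x' y' hxy hxy'
  by_contra! hcon
  obtain ⟨h1, h2⟩ := hcon
  rw [hφ] at h1 h2 hxy hxy'
  push Not at h1 h2
  obtain ⟨a, ha, b', hb', h1⟩ := h1
  obtain ⟨a', ha', b, hb, h2⟩ := h2
  exact absurd (((hxy a ha b hb).trans_le h2).trans (hxy' a' ha' b' hb')) (not_lt.2 h1)

theorem TwoPlusTwoFree.Iio_total {P : Type u} [PartialOrder P] (h : TwoPlusTwoFree P) (x y : P) :
    Set.Iio x ⊆ Set.Iio y ∨ Set.Iio y ⊆ Set.Iio x := by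
  by_contra! hcon
  obtain ⟨h1, h2⟩ := hcon
  obtain ⟨a, ha, ha'⟩ := Set.not_subset.1 h1
  obtain ⟨b, hb, hb'⟩ := Set.not_subset.1 h2
  exact (h a x b y ha hb).elim ha' hb'

/-- The elements of a poset, to be ordered by their sets of strict predecessors. -/
def ByPredecessors (P : Type u) : Type u := P

/-- The elements of a `2 ⊕ 2`-free poset, ordered linearly by their sets of strict predecessors, with
ties broken by an auxiliary linear order. -/
noncomputable abbrev TwoPlusTwoFree.linearOrder {P : Type u} [PartialOrder P]
    (h : TwoPlusTwoFree P) (w : LinearOrder P) : LinearOrder (ByPredecessors P) where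
  le (x y : P) := Set.Iio x ⊂ Set.Iio y ∨ (Set.Iio x = Set.Iio y ∧ w.le x y)
  le_refl x := Or.inr ⟨rfl, w.le_refl x⟩
  le_trans x y z := by
    rintro (h1 | ⟨h1, h1'⟩) (h2 | ⟨h2, h2'⟩)
    · exact Or.inl (h1.trans h2)
    · exact Or.inl (h2 ▸ h1)
    · exact Or.inl (h1 ▸ h2)
    · exact Or.inr ⟨h1.trans h2, w.le_trans x y z h1' h2'⟩
  le_antisymm x y := by
    rintro (h1 | ⟨h1, h1'⟩) (h2 | ⟨h2, h2'⟩)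
    · exact absurd (h1.trans h2) (ssubset_irrefl _)
    · exact absurd (h2 ▸ h1) (ssubset_irrefl _)
    · exact absurd (h1 ▸ h2) (ssubset_irrefl _)
    · exact w.le_antisymm x y h1' h2'
  le_total (x y : P) := by
    by_cases he : Set.Iio x = Set.Iio y
    · exact (w.le_total x y).imp (fun h ↦ Or.inr ⟨he, h⟩) (fun h ↦ Or.inr ⟨he.symm, h⟩)
    · exact (h.Iio_total x y).imp (fun h ↦ Or.inl (h.ssubset_of_ne he))
        (fun h ↦ Or.inl (h.ssubset_of_ne (Ne.symm he)))
  toDecidableLE := Classical.decRel _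

theorem TwoPlusTwoFree.exists_linearOrder {P : Type u} [PartialOrder P] (h : TwoPlusTwoFree P) :
    ∃ (C : Type u) (_ : LinearOrder C) (e : P ≃ C),
      ∀ x y, e x ≤ e y → Set.Iio x ⊆ Set.Iio y := by
  obtain ⟨w, -⟩ := exists_wellFoundedLT P
  refine ⟨ByPredecessors P, h.linearOrder w, Equiv.refl P, fun x y hxy ↦ ?_⟩
  rcases hxy with h1 | ⟨h1, -⟩
  exacts [h1.subset, h1.subset]

theorem TwoPlusTwoFree.isIntervalOrder {P : Type u} [PartialOrder P] (h : TwoPlusTwoFree P) :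
    IsIntervalOrder P := by
  obtain ⟨C, _, e, sub⟩ := h.exists_linearOrder
  -- The interval of `x` starts at `e x` and stops before the first element above `x`. It is convex
  -- because predecessor sets grow along `C`, and injectivity holds because `e x` is its least
  -- element.
  let φ : P → Set C := fun x ↦ e '' {z | e x ≤ e z ∧ ¬ x < z}
  have mem (x z : P) : e z ∈ φ x ↔ e x ≤ e z ∧ ¬ x < z := e.injective.mem_set_image
  have self (x : P) : e x ∈ φ x := (mem x x).2 ⟨le_rfl, lt_irrefl x⟩
  refine ⟨C, _, φ, fun x y hxy ↦ ?_, fun x ↦ ⟨⟨_, self x⟩, ⟨?_⟩⟩, fun x y ↦ ⟨?_, fun hab ↦ ?_⟩⟩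
  · exact e.injective (((mem x y).1 (hxy ▸ self y)).1.antisymm ((mem y x).1 (hxy ▸ self x)).1)
  · rintro _ ⟨a, ha, rfl⟩ _ ⟨b, hb, rfl⟩ c hc
    obtain ⟨c, rfl⟩ := e.surjective c
    exact (mem x c).2 ⟨ha.1.trans hc.1, fun hxc ↦ hb.2 (sub c b hc.2 hxc)⟩
  · rintro hxy _ ⟨a, ha, rfl⟩ _ ⟨b, hb, rfl⟩
    exact not_le.1 fun hba ↦ ha.2 (sub b a hba (sub y b hb.1 hxy))
  · by_contra hxy
    rcases le_total (e x) (e y) with hle | hle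
    · exact lt_irrefl _ (hab _ ((mem x y).2 ⟨hle, hxy⟩) _ (self y))
    · exact hle.not_gt (hab _ (self x) _ (self y))

theorem isIntervalOrder_iff_twoPlusTwoFree {P : Type u} [PartialOrder P] :
    IsIntervalOrder P ↔ TwoPlusTwoFree P :=
  ⟨fun h ↦ h.twoPlusTwoFree, fun h ↦ h.isIntervalOrder⟩

theorem IsIOFin.of_orderEmbedding {P P' : Type u} [PartialOrder P] [PartialOrder P']
    (f : P ↪o P') (h : IsIOFin P') : IsIOFin P := by
  refine ⟨isIntervalOrder_iff_twoPlusTwoFree.2 fun x y x' y' hxy hxy' ↦ ?_, fun s hs ↦ ?_⟩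
  · simpa using h.1.twoPlusTwoFree (f x) (f y) (f x') (f y') (by simpa) (by simpa)
  · exact Set.Finite.of_finite_image
      (h.2 _ (hs.image_embedding (φ := f))) f.injective.injOn

theorem IsIOFin.isFiniteAntichainPoset {P : Type u} [PartialOrder P] (h : IsIOFin P)
    (hP : ∀ x y : P, ¬ x < y) : IsFiniteAntichainPoset P := by
  refine ⟨?_, fun x y hxy ↦ hxy.eq_of_not_lt (hP x y)⟩
  rw [← Set.finite_univ_iff]
  exact h.2 _ fun x _ y _ hne hle ↦ hP x y (hle.lt_of_ne hne)

/-! ### Lexicographical sums -/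

section LexSum

variable {Q : Type u} [PartialOrder Q] {V : Q → Type u} [∀ i, PartialOrder (V i)]

theorem lexSum_lt_iff {a b : Σₗ i, V i} :
    a < b ↔ a.1 < b.1 ∨ ∃ h : a.1 = b.1, h ▸ a.2 < b.2 :=
  Sigma.Lex.lt_def

theorem lexSum_fst_le {a b : Σₗ i, V i} (h : a < b) : a.1 ≤ b.1 := by
  rcases lexSum_lt_iff.1 h with h | ⟨h, -⟩
  exacts [h.le, h.le]

theorem exists_lt_of_lexSum_lt {a b : Σₗ i, V i} (h : a < b) (he : a.1 = b.1) :
    ∃ x y : V a.1, x < y := by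
  rcases lexSum_lt_iff.1 h with h | ⟨h, h'⟩
  · exact absurd he h.ne
  · obtain ⟨i, a⟩ := a
    obtain ⟨j, b⟩ := b
    dsimp only at h
    subst h
    exact ⟨a, b, h'⟩

theorem not_isFiniteAntichainPoset_of_lt {P : Type u} [PartialOrder P] {x y : P} (h : x < y) :
    ¬ IsFiniteAntichainPoset P :=
  fun hP ↦ h.ne (hP.2 x y h.le)

theorem lexSum_twoPlusTwo_of_fst_eq (hV : ∀ i, TwoPlusTwoFree (V i)) {a b a' b' : Σₗ i, V i}
    (h : a < b) (h' : a' < b') (hb : a.1 = b.1) (ha' : a.1 = a'.1) (hb' : a.1 = b'.1) :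
    a < b' ∨ a' < b := by
  rw [lexSum_lt_iff] at h h' ⊢
  rw [lexSum_lt_iff]
  obtain ⟨i, a⟩ := a
  obtain ⟨j, b⟩ := b
  obtain ⟨k, a'⟩ := a'
  obtain ⟨l, b'⟩ := b'
  dsimp only at hb ha' hb' h h' ⊢
  subst hb ha' hb'
  simp only [lt_self_iff_false, false_or, exists_const] at h h' ⊢
  exact hV _ _ _ _ _ h h'

theorem lexSum_antichain_finite (hQ : ∀ s : Set Q, IsAntichain (· ≤ ·) s → s.Finite)
    (hV : ∀ i, ∀ s : Set (V i), IsAntichain (· ≤ ·) s → s.Finite)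
    (s : Set (Σₗ i, V i)) (hs : IsAntichain (· ≤ ·) s) : s.Finite := by
  have hfst : (Sigma.fst '' (ofLex '' s)).Finite := by
    refine hQ _ ?_
    rintro _ ⟨_, ⟨a, ha, rfl⟩, rfl⟩ _ ⟨_, ⟨b, hb, rfl⟩, rfl⟩ hne hle
    have hlt : a < b := lexSum_lt_iff.2 (Or.inl (lt_of_le_of_ne hle hne))
    exact hs ha hb hlt.ne hlt.le
  have hfib : ∀ i, {v : V i | toLex ⟨i, v⟩ ∈ s}.Finite := by
    intro i
    refine hV i _ fun v hv w hw hne hle ↦ ?_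
    have hlt : (toLex ⟨i, v⟩ : Σₗ i, V i) < toLex ⟨i, w⟩ :=
      lexSum_lt_iff.2 (Or.inr ⟨rfl, lt_of_le_of_ne hle hne⟩)
    exact hs hv hw hlt.ne hlt.le
  refine (hfst.biUnion fun i _ ↦ (hfib i).image fun v ↦ (toLex ⟨i, v⟩ : Σₗ i, V i)).subset ?_
  intro a ha
  exact Set.mem_biUnion ⟨_, ⟨a, ha, rfl⟩, rfl⟩ ⟨a.2, ha, rfl⟩

theorem isIOFin_lexSum (hV : ∀ i, IsIOFin (V i))
    (hQ : ∀ s : Set Q, IsAntichain (· ≤ ·) s → s.Finite)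
    (h : TwoPlusTwoFree (Σₗ i, V i)) : IsIOFin (Σₗ i, V i) :=
  ⟨h.isIntervalOrder, lexSum_antichain_finite hQ fun i ↦ (hV i).2⟩

theorem isIOFin_lexSum_of_chain (hV : ∀ i, IsIOFin (V i)) (hQ : IsChainPoset Q) :
    IsIOFin (Σₗ i, V i) := by
  refine isIOFin_lexSum hV (fun s hs ↦ Set.Subsingleton.finite fun x hx y hy ↦ ?_)
    fun a b a' b' h h' ↦ ?_
  · exact (hQ x y).elim (hs.eq hx hy) fun hyx ↦ (hs.eq hy hx hyx).symm
  · by_contra! hcon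
    have le_of (i j : Q) (hn : ¬ i < j) : j ≤ i :=
      (hQ j i).elim id fun hij ↦ (hij.eq_of_not_lt hn).ge
    have h1 := le_of _ _ fun hlt ↦ hcon.1 (lexSum_lt_iff.2 (Or.inl hlt))
    have h2 := le_of _ _ fun hlt ↦ hcon.2 (lexSum_lt_iff.2 (Or.inl hlt))
    have hab := lexSum_fst_le h
    have hab' := lexSum_fst_le h'
    -- The indices satisfy `a ≤ b ≤ a' ≤ b' ≤ a`, so all four coincide.
    exact not_or.2 hcon (lexSum_twoPlusTwo_of_fst_eq (fun i ↦ (hV i).1.twoPlusTwoFree) h h'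
      (hab.antisymm (h2.trans (hab'.trans h1))) ((hab.trans h2).antisymm (hab'.trans h1))
      ((hab.trans (h2.trans hab')).antisymm h1))

theorem isIOFin_lexSum_of_antichain (hV : ∀ i, IsIOFin (V i)) (hQ : IsFiniteAntichainPoset Q)
    (hone : ∀ i j, ¬ IsFiniteAntichainPoset (V i) → ¬ IsFiniteAntichainPoset (V j) → i = j) :
    IsIOFin (Σₗ i, V i) := by
  have := hQ.1
  refine isIOFin_lexSum hV (fun s _ ↦ s.toFinite) fun a b a' b' h h' ↦ ?_
  have hab := hQ.2 _ _ (lexSum_fst_le h)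
  have hab' := hQ.2 _ _ (lexSum_fst_le h')
  obtain ⟨x, y, hxy⟩ := exists_lt_of_lexSum_lt h hab
  obtain ⟨x', y', hxy'⟩ := exists_lt_of_lexSum_lt h' hab'
  have haa' := hone _ _ (not_isFiniteAntichainPoset_of_lt hxy) (not_isFiniteAntichainPoset_of_lt hxy')
  exact lexSum_twoPlusTwo_of_fst_eq (fun i ↦ (hV i).1.twoPlusTwoFree) h h' hab haa'
    (haa'.trans hab')

/-- In a prime poset that is not an antichain, two incomparable elements are not both singular. -/
theorem IsPrimePoset.not_isSingular (hQ : IsPrimePoset Q) (hna : ¬ IsAntichainPoset Q) {i k : Q}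
    (hik : ¬ i ≤ k) (hki : ¬ k ≤ i) (hi : IsSingular i) : ¬ IsSingular k := by
  intro hk
  -- If `x` were comparable to `k` but not to `i`, then `x` and `k` would be comparable elements
  -- both incomparable to `i`. Used symmetrically, this makes `{i, k}` a module.
  have key (i k x : Q) (hik : ¬ i ≤ k) (hki : ¬ k ≤ i) (hi : IsSingular i) (hxk : x ≠ k) :
      (x ≤ k → x ≤ i) ∧ (k ≤ x → i ≤ x) := by
    refine ⟨fun h ↦ ?_, fun h ↦ ?_⟩
    · by_contra hn
      exact hxk (hi.eq ⟨fun h' ↦ hik (h'.trans h), hn⟩ ⟨hik, hki⟩ h)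
    · by_contra hn
      exact hxk (hi.eq ⟨hik, hki⟩ ⟨hn, fun h' ↦ hki (h.trans h')⟩ h).symm
  have hmod : IsPosetModule ({i, k} : Set Q) := by
    intro a ha b hb x hx
    have h1 := key i k x hik hki hi fun e ↦ hx (Or.inr e)
    have h2 := key k i x hki hik hk fun e ↦ hx (Or.inl e)
    have h : (x ≤ i ↔ x ≤ k) ∧ (i ≤ x ↔ k ≤ x) := ⟨⟨h2.1, h1.1⟩, ⟨h2.2, h1.2⟩⟩
    rcases ha with rfl | rfl <;> rcases hb with rfl | rfl
    exacts [⟨Iff.rfl, Iff.rfl⟩, h, ⟨h.1.symm, h.2.symm⟩, ⟨Iff.rfl, Iff.rfl⟩]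
  rcases hQ _ hmod with h | ⟨x, h⟩ | h
  · exact (h ▸ Set.mem_insert i {k} : i ∈ (∅ : Set Q))
  · have h1 : i = x := by simpa using (h ▸ Set.mem_insert i {k} : i ∈ ({x} : Set Q))
    have h2 : k = x := by simpa using (h ▸ Or.inr rfl : k ∈ ({x} : Set Q))
    exact hik (h1.trans h2.symm).le
  · refine hna fun x y hxy ↦ ?_
    have hx : x ∈ ({i, k} : Set Q) := h ▸ Set.mem_univ x
    have hy : y ∈ ({i, k} : Set Q) := h ▸ Set.mem_univ y
    rcases hx with rfl | rfl <;> rcases hy with rfl | rfl <;> first | rfl | contradiction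

/-- The pair `a < b` makes its index singular. If the other pair avoids that component, both its
indices are incomparable to this one, so singularity merges them; that second index is then singular
too, which primality forbids. -/
theorem lexSum_twoPlusTwo_of_singular (hV : ∀ i, TwoPlusTwoFree (V i)) (hQ : IsPrimePoset Q)
    (hna : ¬ IsAntichainPoset Q) (hs : ∀ i, ¬ IsSingular i → IsFiniteAntichainPoset (V i))
    {a b a' b' : Σₗ i, V i} (h : a < b) (h' : a' < b') (hab : a.1 = b.1) : a < b' ∨ a' < b := by
  by_contra! hcon
  have h1 : ¬ a.1 < b'.1 := fun hlt ↦ hcon.1 (lexSum_lt_iff.2 (Or.inl hlt))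
  have h2 : ¬ a'.1 < a.1 := fun hlt ↦ hcon.2 (lexSum_lt_iff.2 (Or.inl (hab ▸ hlt)))
  have hle := lexSum_fst_le h'
  obtain ⟨x, y, hxy⟩ := exists_lt_of_lexSum_lt h hab
  have hsing : IsSingular a.1 := by
    by_contra hn
    exact not_isFiniteAntichainPoset_of_lt hxy (hs _ hn)
  have same (e1 : a.1 = a'.1) (e2 : a.1 = b'.1) : False :=
    not_or.2 hcon (lexSum_twoPlusTwo_of_fst_eq hV h h' hab e1 e2)
  have n1 : a.1 ≠ a'.1 := fun e ↦ same e ((e.trans_le hle).eq_of_not_lt h1)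
  have n2 : a.1 ≠ b'.1 := fun e ↦ same ((e ▸ hle).eq_of_not_lt h2).symm e
  have i1 : ¬ a.1 ≤ a'.1 := fun hl ↦ h1 ((hl.lt_of_ne n1).trans_le hle)
  have i2 : ¬ a'.1 ≤ a.1 := fun hl ↦ h2 (hl.lt_of_ne n1.symm)
  have i3 : ¬ a.1 ≤ b'.1 := fun hl ↦ h1 (hl.lt_of_ne n2)
  have i4 : ¬ b'.1 ≤ a.1 := fun hl ↦ i2 (hle.trans hl)
  have heq : a'.1 = b'.1 := hsing.eq ⟨i1, i2⟩ ⟨i3, i4⟩ hle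
  obtain ⟨x', y', hxy'⟩ := exists_lt_of_lexSum_lt h' heq
  exact not_isFiniteAntichainPoset_of_lt hxy' (hs _ (hQ.not_isSingular hna i1 i2 hsing))

theorem isIOFin_lexSum_of_prime (hV : ∀ i, IsIOFin (V i)) (hQ : IsPrimePoset Q) (hFin : IsIOFin Q)
    (hna : ¬ IsAntichainPoset Q) (hs : ∀ i, ¬ IsSingular i → IsFiniteAntichainPoset (V i)) :
    IsIOFin (Σₗ i, V i) := by
  refine isIOFin_lexSum hV hFin.2 fun a b a' b' h h' ↦ ?_
  have hV' := fun i ↦ (hV i).1.twoPlusTwoFree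
  rcases (lexSum_fst_le h).eq_or_lt with hab | hab
  · exact lexSum_twoPlusTwo_of_singular hV' hQ hna hs h h' hab
  rcases (lexSum_fst_le h').eq_or_lt with hab' | hab'
  · exact (lexSum_twoPlusTwo_of_singular hV' hQ hna hs h' h hab').symm
  · exact (hFin.1.twoPlusTwoFree _ _ _ _ hab hab').imp (fun h ↦ lexSum_lt_iff.2 (Or.inl h))
      (fun h ↦ lexSum_lt_iff.2 (Or.inl h))

/-- A poset is the lexicographical sum of the fibres of a map that reflects and preserves the order
between different fibres. -/
noncomputable def orderIsoLexSumFiber {P : Type u} [PartialOrder P] (π : P → Q)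
    (hπ : ∀ x y, π x ≠ π y → (x ≤ y ↔ π x < π y)) : P ≃o Σₗ i, {x // π x = i} where
  toFun x := toLex ⟨π x, x, rfl⟩
  invFun a := a.2.1
  left_inv _ := rfl
  right_inv := by
    rintro ⟨i, x, rfl⟩
    rfl
  map_rel_iff' := by
    intro x y
    have cast_le {i j : Q} (h : i = j) (a : {x // π x = i}) (b : {x // π x = j}) :
        h ▸ a ≤ b ↔ a.1 ≤ b.1 := by
      subst h
      rfl
    refine Sigma.Lex.le_def.trans ?_
    change (π x < π y ∨ ∃ h : π x = π y, h ▸ (⟨x, rfl⟩ : {z // π z = π x}) ≤ ⟨y, rfl⟩) ↔ x ≤ y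
    by_cases h : π x = π y
    · simp [cast_le, h]
    · simp [hπ x y h, h]

end LexSum

/-! ### Cuts and modules -/

section Cut

variable {P : Type u} [PartialOrder P]

/-- `S` is a proper nonempty subset lying entirely below its complement. -/
def IsSeriesCut (S : Set P) : Prop :=
  S.Nonempty ∧ Sᶜ.Nonempty ∧ ∀ x ∈ S, ∀ y ∉ S, x < y

/-- `S` is a proper nonempty subset all of whose elements are incomparable to its complement. -/
def IsParallelCut (S : Set P) : Prop :=
  S.Nonempty ∧ Sᶜ.Nonempty ∧ ∀ x ∈ S, ∀ y ∉ S, ¬ x ≤ y ∧ ¬ y ≤ x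

theorem IsPosetModule.sUnion {F : Set (Set P)} {x : P} (hF : ∀ A ∈ F, IsPosetModule A ∧ x ∈ A) :
    IsPosetModule (⋃₀ F) := by
  rintro a ⟨A, hA, ha⟩ b ⟨B, hB, hb⟩ z hz
  have h1 := (hF A hA).1 a ha x (hF A hA).2 z fun h ↦ hz ⟨A, hA, h⟩
  have h2 := (hF B hB).1 x (hF B hB).2 b hb z fun h ↦ hz ⟨B, hB, h⟩
  exact ⟨h1.1.trans h2.1, h1.2.trans h2.2⟩

theorem IsPosetModule.union {A B : Set P} {x : P} (hA : IsPosetModule A) (hB : IsPosetModule B)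
    (hxA : x ∈ A) (hxB : x ∈ B) : IsPosetModule (A ∪ B) := by
  rw [← Set.sUnion_pair]
  refine IsPosetModule.sUnion (x := x) ?_
  rintro C (rfl | rfl)
  exacts [⟨hA, hxA⟩, ⟨hB, hxB⟩]

theorem IsPosetModule.singleton (x : P) : IsPosetModule ({x} : Set P) := by
  rintro a rfl b rfl z -
  exact ⟨Iff.rfl, Iff.rfl⟩

/-- If `A` and `B` covered `P`, a point outside `B` would lie in `A`. Moving within `B` to a point
`y ∉ A`, then within `A` to `c`, shows that all points outside `B` relate to all of `B` as `c` does
to `y`: a cut. -/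
theorem IsPosetModule.union_ne_univ (hser : ∀ S : Set P, ¬ IsSeriesCut S)
    (hpar : ∀ S : Set P, ¬ IsParallelCut S) {A B : Set P} {c : P} (hA : IsPosetModule A)
    (hB : IsPosetModule B) (hcA : c ∈ A) (hA' : A ≠ Set.univ) (hB' : B ≠ Set.univ) :
    A ∪ B ≠ Set.univ := by
  intro hU
  obtain ⟨y, hy⟩ := (Set.ne_univ_iff_exists_notMem _).1 hA'
  obtain ⟨x, hx⟩ := (Set.ne_univ_iff_exists_notMem _).1 hB'
  have hyB : y ∈ B := ((Set.ext_iff.1 hU y).2 trivial).resolve_left hy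
  have hmem : ∀ z ∉ B, z ∈ A := fun z hz ↦ ((Set.ext_iff.1 hU z).2 trivial).resolve_right hz
  have hrel : ∀ z ∉ B, ∀ b ∈ B, (z ≤ b ↔ c ≤ y) ∧ (b ≤ z ↔ y ≤ c) := fun z hz b hb ↦
    ⟨((hB b hb y hyB z hz).1).trans (hA z (hmem z hz) c hcA y hy).2,
      ((hB b hb y hyB z hz).2).trans (hA z (hmem z hz) c hcA y hy).1⟩
  by_cases h1 : c ≤ y
  · refine hser Bᶜ ⟨⟨x, hx⟩, ⟨y, not_not.2 hyB⟩, fun z hz b hb ↦ ?_⟩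
    have hb : b ∈ B := not_not.1 hb
    exact ((hrel z hz b hb).1.2 h1).lt_of_ne fun e ↦ hz (e ▸ hb)
  by_cases h2 : y ≤ c
  · refine hser B ⟨⟨y, hyB⟩, ⟨x, hx⟩, fun b hb z hz ↦ ?_⟩
    exact ((hrel z hz b hb).2.2 h2).lt_of_ne fun e ↦ hz (e ▸ hb)
  · exact hpar B ⟨⟨y, hyB⟩, ⟨x, hx⟩, fun b hb z hz ↦
      ⟨fun h ↦ h2 ((hrel z hz b hb).2.1 h), fun h ↦ h1 ((hrel z hz b hb).1.1 h)⟩⟩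

/-- Otherwise every outside point is above or below all of `M`. The points below `M`, or `M` itself
if there are none, then form a series cut. -/
theorem IsPosetModule.exists_incomparable (hser : ∀ S : Set P, ¬ IsSeriesCut S) {M : Set P} {x : P}
    (hM : IsPosetModule M) (hx : x ∈ M) (hM' : M ≠ Set.univ) :
    ∃ y, ∀ z ∈ M, ¬ y ≤ z ∧ ¬ z ≤ y := by
  by_contra! hcon
  have hcmp : ∀ y ∉ M, y ≤ x ∨ x ≤ y := by
    intro y hy
    obtain ⟨z, hz, h⟩ := hcon y
    by_cases hyz : y ≤ z
    · exact Or.inl ((hM z hz x hx y hy).1.1 hyz)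
    · exact Or.inr ((hM z hz x hx y hy).2.1 (h hyz))
  have hlt : ∀ y ∉ M, y ≤ x → ∀ z ∈ M, y < z := fun y hy hyx z hz ↦
    ((hM x hx z hz y hy).1.1 hyx).lt_of_ne fun e ↦ hy (e ▸ hz)
  have hgt : ∀ y ∉ M, x ≤ y → ∀ z ∈ M, z < y := fun y hy hyx z hz ↦
    ((hM x hx z hz y hy).2.1 hyx).lt_of_ne fun e ↦ hy (e ▸ hz)
  by_cases hL : ∃ y ∉ M, y ≤ x
  · obtain ⟨y, hy, hyx⟩ := hL
    refine hser {y | y ∉ M ∧ y ≤ x} ⟨⟨y, hy, hyx⟩, ⟨x, fun h ↦ h.1 hx⟩, fun z hz w hw ↦ ?_⟩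
    by_cases hwM : w ∈ M
    · exact hlt z hz.1 hz.2 w hwM
    · have hxw := (hcmp w hwM).resolve_left fun h ↦ hw ⟨hwM, h⟩
      exact (hlt z hz.1 hz.2 x hx).trans (hgt w hwM hxw x hx)
  · push Not at hL
    obtain ⟨y, hy⟩ := (Set.ne_univ_iff_exists_notMem _).1 hM'
    exact hser M ⟨⟨x, hx⟩, ⟨y, hy⟩, fun z hz w hw ↦
      hgt w hw ((hcmp w hw).resolve_left (hL w hw)) z hz⟩

/-- The union of all proper modules containing `x`. -/
def properModuleHull (x : P) : Set P :=
  ⋃₀ {A | IsPosetModule A ∧ x ∈ A ∧ A ≠ Set.univ}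

theorem isPosetModule_properModuleHull (x : P) : IsPosetModule (properModuleHull x) :=
  IsPosetModule.sUnion fun _ hA ↦ ⟨hA.1, hA.2.1⟩

theorem IsPosetModule.subset_properModuleHull {A : Set P} {x : P} (hA : IsPosetModule A)
    (hx : x ∈ A) (hA' : A ≠ Set.univ) : A ⊆ properModuleHull x :=
  Set.subset_sUnion_of_mem ⟨hA, hx, hA'⟩

theorem mem_properModuleHull_self [Nontrivial P] (x : P) : x ∈ properModuleHull x :=
  (IsPosetModule.singleton x).subset_properModuleHull rfl (Set.singleton_ne_univ x) rfl

/-- If the hull were everything, any proper module `M` through `x` could be enlarged, staying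
proper, to absorb a point incomparable to all of `M`. Iterating, the absorbed points form an
infinite antichain. -/
theorem properModuleHull_ne_univ [Nontrivial P] (hser : ∀ S : Set P, ¬ IsSeriesCut S)
    (hpar : ∀ S : Set P, ¬ IsParallelCut S) (hfin : ∀ s : Set P, IsAntichain (· ≤ ·) s → s.Finite)
    (x : P) : properModuleHull x ≠ Set.univ := by
  intro hU
  let F := {A : Set P // IsPosetModule A ∧ x ∈ A ∧ A ≠ Set.univ}
  have hy (M : F) : ∃ y, ∀ z ∈ M.1, ¬ y ≤ z ∧ ¬ z ≤ y :=
    M.2.1.exists_incomparable hser M.2.2.1 M.2.2.2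
  choose y hy using hy
  have hN (M : F) : ∃ N : F, M.1 ⊆ N.1 ∧ y M ∈ N.1 := by
    obtain ⟨B, hB, hyB⟩ : y M ∈ properModuleHull x := hU ▸ Set.mem_univ _
    exact ⟨⟨M.1 ∪ B, M.2.1.union hB.1 M.2.2.1 hB.2.1, Or.inl M.2.2.1,
      M.2.1.union_ne_univ hser hpar hB.1 M.2.2.1 M.2.2.2 hB.2.2⟩,
      Set.subset_union_left, Or.inr hyB⟩
  choose N hN using hN
  let seq : ℕ → F := fun n ↦ N^[n] ⟨{x}, IsPosetModule.singleton x, rfl, Set.singleton_ne_univ x⟩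
  have hsucc (n : ℕ) : seq (n + 1) = N (seq n) := Function.iterate_succ_apply' ..
  have hmono : Monotone fun n ↦ (seq n).1 := monotone_nat_of_le_succ fun n ↦ by
    rw [hsucc]
    exact (hN _).1
  have hmem {m n : ℕ} (h : m < n) : y (seq m) ∈ (seq n).1 :=
    hmono (Nat.succ_le_of_lt h) (by
      change y (seq m) ∈ (seq (m + 1)).1
      rw [hsucc]
      exact (hN _).2)
  have hinc {m n : ℕ} (h : m ≠ n) : ¬ y (seq m) ≤ y (seq n) := by
    rcases h.lt_or_gt with h | h
    exacts [(hy _ _ (hmem h)).2, (hy _ _ (hmem h)).1]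
  have hinj : Function.Injective fun n ↦ y (seq n) := fun m n h ↦ by
    by_contra hne
    exact hinc hne (le_of_eq h)
  refine Set.infinite_range_of_injective hinj (hfin _ ?_)
  rintro _ ⟨m, rfl⟩ _ ⟨n, rfl⟩ hne
  exact hinc fun e ↦ hne (by rw [e])

end Cut

/-! ### The decomposition -/

section Decomposition

variable {P : Type u} [PartialOrder P]

theorem IsIOFin.subtype (hP : IsIOFin P) (p : P → Prop) : IsIOFin {x // p x} :=
  hP.of_orderEmbedding (OrderEmbedding.subtype p)

theorem exists_chain_lexSum (hP : IsIOFin P) {S : Set P} (hS : IsSeriesCut S) :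
    ∃ (Q : Type u) (_ : PartialOrder Q) (V : Q → Type u) (_ : ∀ i, PartialOrder (V i)),
      Nontrivial Q ∧ (∀ i, Nonempty (V i)) ∧ (∀ i, IsIOFin (V i)) ∧
      Nonempty (P ≃o Σₗ i, V i) ∧ IsChainPoset Q := by
  classical
  obtain ⟨⟨s, hs⟩, ⟨t, ht⟩, h⟩ := hS
  -- The negation sends `S` to `false`, the bottom element.
  let π : P → ULift.{u} Bool := fun x ↦ ⟨decide (x ∉ S)⟩
  refine ⟨ULift Bool, inferInstance, fun i ↦ {x // π x = i}, inferInstance, inferInstance, ?_,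
    fun i ↦ hP.subtype _, ⟨orderIsoLexSumFiber π ?_⟩, fun x y ↦ le_total x y⟩
  · rintro ⟨_ | _⟩
    · exact ⟨s, by simpa [π] using hs⟩
    · exact ⟨t, by simpa [π] using ht⟩
  · intro x y hne
    by_cases hx : x ∈ S <;> by_cases hy : y ∈ S
    · simp [π, hx, hy] at hne
    · simpa [π, hx, hy, ← ULift.down_lt] using (h x hx y hy).le
    · exact iff_of_false (h y hy x hx).not_ge (by simp [π, hx, hy, ← ULift.down_lt])
    · simp [π, hx, hy] at hne

/-- The antichain with two elements. -/
def AntichainPair : Type u := ULift Prop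

instance : Nontrivial AntichainPair.{u} := inferInstanceAs (Nontrivial (ULift Prop))

instance : Finite AntichainPair.{u} := inferInstanceAs (Finite (ULift Prop))

instance : PartialOrder AntichainPair.{u} where
  le := Eq
  le_refl := Eq.refl
  le_trans _ _ _ := Eq.trans
  le_antisymm _ _ h _ := h

theorem exists_antichain_lexSum (hP : IsIOFin P) {S : Set P} (hS : IsParallelCut S) :
    ∃ (Q : Type u) (_ : PartialOrder Q) (V : Q → Type u) (_ : ∀ i, PartialOrder (V i)),
      Nontrivial Q ∧ (∀ i, Nonempty (V i)) ∧ (∀ i, IsIOFin (V i)) ∧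
      Nonempty (P ≃o Σₗ i, V i) ∧ IsFiniteAntichainPoset Q ∧
      ∀ i j, ¬ IsFiniteAntichainPoset (V i) → ¬ IsFiniteAntichainPoset (V j) → i = j := by
  classical
  obtain ⟨⟨s, hs⟩, ⟨t, ht⟩, h⟩ := hS
  let π : P → AntichainPair.{u} := fun x ↦ ULift.up (x ∈ S)
  have hπ (x y : P) (h : x ∈ S ↔ y ∈ S) : π x = π y := congrArg ULift.up (propext h)
  have hinc (x y : P) (hne : π x ≠ π y) : ¬ x ≤ y := by
    by_cases hx : x ∈ S <;> by_cases hy : y ∈ S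
    · exact absurd (hπ x y (iff_of_true hx hy)) hne
    · exact (h x hx y hy).1
    · exact (h y hy x hx).2
    · exact absurd (hπ x y (iff_of_false hx hy)) hne
  have hFin (i) : IsIOFin {x // π x = i} := hP.subtype _
  refine ⟨AntichainPair, inferInstance, fun i ↦ {x // π x = i}, inferInstance, inferInstance, ?_, hFin,
    ⟨orderIsoLexSumFiber π fun x y hne ↦ iff_of_false (hinc x y hne) fun hlt ↦ hne hlt.le⟩,
    ⟨inferInstance, fun _ _ h ↦ h⟩, fun i j hi hj ↦ ?_⟩
  · rintro ⟨p⟩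
    by_cases hp : p
    · exact ⟨s, congrArg ULift.up (propext (iff_of_true hs hp))⟩
    · exact ⟨t, congrArg ULift.up (propext (iff_of_false ht hp))⟩
  · by_contra hij
    have hlt (i) (hi : ¬ IsFiniteAntichainPoset {x // π x = i}) :
        ∃ x y, x < y ∧ π x = i ∧ π y = i := by
      by_contra! hcon
      exact hi ((hFin i).isFiniteAntichainPoset fun x y hxy ↦ hcon x y hxy x.2 y.2)
    obtain ⟨x, y, hxy, hx, hy⟩ := hlt i hi
    obtain ⟨x', y', hxy', hx', hy'⟩ := hlt j hj
    rcases hP.1.twoPlusTwoFree x y x' y' hxy hxy' with h | h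
    · exact hinc x y' (by rwa [hx, hy']) h.le
    · exact hinc x' y (by rw [hx', hy]; exact Ne.symm hij) h.le

theorem exists_prime_lexSum [Nontrivial P] (hP : IsIOFin P) (hser : ∀ S : Set P, ¬ IsSeriesCut S)
    (hpar : ∀ S : Set P, ¬ IsParallelCut S) :
    ∃ (Q : Type u) (_ : PartialOrder Q) (V : Q → Type u) (_ : ∀ i, PartialOrder (V i)),
      Nontrivial Q ∧ (∀ i, Nonempty (V i)) ∧ (∀ i, IsIOFin (V i)) ∧
      Nonempty (P ≃o Σₗ i, V i) ∧ IsPrimePoset Q ∧ IsIOFin Q ∧ ¬ IsAntichainPoset Q ∧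
      ∀ i, ¬ IsSingular i → IsFiniteAntichainPoset (V i) := by
  have hself := mem_properModuleHull_self (P := P)
  have hmod := isPosetModule_properModuleHull (P := P)
  have hne := properModuleHull_ne_univ hser hpar hP.2
  have hsub {x y : P} (h : y ∈ properModuleHull x) : properModuleHull x ⊆ properModuleHull y :=
    (hmod x).subset_properModuleHull h (hne x)
  have heq {x y : P} (h : y ∈ properModuleHull x) : properModuleHull x = properModuleHull y :=
    (hsub h).antisymm (hsub (hsub h (hself x)))
  let s : Setoid P := Setoid.ker properModuleHull
  -- Choosing representatives realises the quotient as a subposet of `P`, so `IsIOFin` is inherited.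
  let r : P → P := fun x ↦ (Quotient.mk s x).out
  have hr (x : P) : properModuleHull (r x) = properModuleHull x := Quotient.mk_out (s := s) x
  have hr_eq {x y : P} (h : properModuleHull x = properModuleHull y) : r x = r y :=
    congrArg Quotient.out (Quotient.sound (s := s) h)
  have hrr (x : P) : r (r x) = r x := hr_eq (hr x)
  have mem_hull {x y : P} (h : r x = r y) : x ∈ properModuleHull y := by
    rw [← hr y, ← h, hr x]
    exact hself x
  have notMem_hull {x y : P} (h : r x ≠ r y) : x ∉ properModuleHull y :=
    fun hm ↦ h (hr_eq (heq hm).symm)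
  have hle {x y x' y' : P} (hx : r x = r x') (hy : r y = r y') (hn : r x ≠ r y) :
      x ≤ y ↔ x' ≤ y' := by
    refine ((hmod y y (hself y) y' (mem_hull hy.symm) x (notMem_hull hn)).1).trans ?_
    exact (hmod x x (hself x) x' (mem_hull hx.symm) y' (notMem_hull (by rw [← hy]; exact hn.symm))).2
  let Q := {x : P // r x = x}
  let π : P → Q := fun x ↦ ⟨r x, hrr x⟩
  have hπ_r {x y : P} : π x = π y ↔ r x = r y := Subtype.ext_iff
  have hπ_self (i : Q) : π i.1 = i := Subtype.ext i.2
  have hπ (x y : P) (hn : π x ≠ π y) : x ≤ y ↔ π x < π y := by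
    rw [Ne, hπ_r] at hn
    rw [hle (hrr x).symm (hrr y).symm hn, lt_iff_le_and_ne, and_iff_left (fun e ↦ hn (hπ_r.1 e))]
    rfl
  have hnt : Nontrivial Q := by
    obtain ⟨x⟩ := Nontrivial.to_nonempty (α := P)
    obtain ⟨y, hy⟩ := (Set.ne_univ_iff_exists_notMem _).1 (hne x)
    exact ⟨π x, π y, fun h ↦ hy (mem_hull (hπ_r.1 h).symm)⟩
  have hFin (i : Q) : IsIOFin {x // π x = i} := hP.subtype _
  refine ⟨Q, inferInstance, fun i ↦ {x // π x = i}, inferInstance, hnt, fun i ↦ ⟨i.1, hπ_self i⟩,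
    hFin, ⟨orderIsoLexSumFiber π hπ⟩, ?_, hP.subtype _, ?_, ?_⟩
  · intro A hA
    by_cases hAe : A = ∅
    · exact Or.inl hAe
    by_cases hAu : A = Set.univ
    · exact Or.inr (Or.inr hAu)
    obtain ⟨i, hi⟩ := Set.nonempty_iff_ne_empty.2 hAe
    obtain ⟨k, hk⟩ := (Set.ne_univ_iff_exists_notMem _).1 hAu
    -- The preimage is a proper module of `P`, hence lies within a single hull, so `A` is a
    -- singleton.
    have hpre : IsPosetModule (π ⁻¹' A) := by
      intro a ha b hb z hz
      have hza : π z ≠ π a := fun e ↦ hz (by rwa [Set.mem_preimage, e])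
      have hzb : π z ≠ π b := fun e ↦ hz (by rwa [Set.mem_preimage, e])
      have h := hA _ ha _ hb _ hz
      rw [hπ _ _ hza, hπ _ _ hzb, hπ _ _ hza.symm, hπ _ _ hzb.symm]
      exact ⟨by rw [hza.le_iff_lt.symm, hzb.le_iff_lt.symm, h.1],
        by rw [hza.symm.le_iff_lt.symm, hzb.symm.le_iff_lt.symm, h.2]⟩
    have hsubs : π ⁻¹' A ⊆ properModuleHull i.1 := by
      refine hpre.subset_properModuleHull (by rwa [Set.mem_preimage, hπ_self]) fun hU ↦ hk ?_
      have : k.1 ∈ π ⁻¹' A := hU ▸ Set.mem_univ _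
      rwa [Set.mem_preimage, hπ_self] at this
    refine Or.inr (Or.inl ⟨i, Set.eq_singleton_iff_unique_mem.2 ⟨hi, fun j hj ↦ ?_⟩⟩)
    have hj' : j.1 ∈ properModuleHull i.1 := hsubs (by rwa [Set.mem_preimage, hπ_self])
    by_contra hji
    exact notMem_hull (fun e ↦ hji (Subtype.ext (by rw [← j.2, ← i.2, e]))) hj'
  -- Over an antichain, any fibre would be a parallel cut.
  · intro hanti
    obtain ⟨i, k, hik⟩ := hnt
    refine hpar (π ⁻¹' {i}) ⟨⟨i.1, hπ_self i⟩, ⟨k.1, fun h ↦ hik ?_⟩, fun x hx y hy ↦ ?_⟩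
    · rw [← hπ_self k]
      exact h.symm
    · have hn : π x ≠ π y := fun e ↦ hy (e.symm.trans hx)
      rw [hπ _ _ hn, hπ _ _ hn.symm]
      exact ⟨fun h ↦ hn (hanti _ _ h.le), fun h ↦ hn (hanti _ _ h.le).symm⟩
  · intro i hi
    refine (hFin i).isFiniteAntichainPoset fun x y hxy ↦ hi ?_
    -- A comparable pair in the fibre of `i`, with another among the elements incomparable to `i`,
    -- would be a `2 ⊕ 2`.
    intro j hj k hk hjk hle'
    have hix (z : P) (hz : π z = i) (l : Q) (hl : ¬ i ≤ l ∧ ¬ l ≤ i) : ¬ z ≤ l.1 ∧ ¬ l.1 ≤ z := by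
      have hn : π z ≠ π l.1 := fun e ↦ hl.1 (by rw [← hz, e, hπ_self])
      rw [hπ _ _ hn, hπ _ _ hn.symm, hz, hπ_self]
      exact ⟨fun h ↦ hl.1 h.le, fun h ↦ hl.2 h.le⟩
    rcases hP.1.twoPlusTwoFree x.1 y.1 j.1 k.1 hxy (hle'.lt_of_ne hjk) with h | h
    · exact (hix _ x.2 k hk).1 h.le
    · exact (hix _ y.2 j hj).2 h.le

end Decomposition

theorem theorem1p1 (P : Type u) [PartialOrder P] [Nontrivial P] :
    IsIOFin P ↔
      ∃ (Q : Type u) (_ : PartialOrder Q) (V : Q → Type u) (_ : ∀ i, PartialOrder (V i)),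
        Nontrivial Q ∧ (∀ i, Nonempty (V i)) ∧ (∀ i, IsIOFin (V i)) ∧
        Nonempty (P ≃o Σₗ i, V i) ∧
        (IsChainPoset Q ∨
          (IsFiniteAntichainPoset Q ∧
            ∀ i j, ¬ IsFiniteAntichainPoset (V i) → ¬ IsFiniteAntichainPoset (V j) → i = j) ∨
          (IsPrimePoset Q ∧ IsIOFin Q ∧ ¬ IsAntichainPoset Q ∧
            ∀ i, ¬ IsSingular i → IsFiniteAntichainPoset (V i))) := by
  constructor
  · intro hP
    by_cases hser : ∃ S : Set P, IsSeriesCut S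
    · obtain ⟨S, hS⟩ := hser
      obtain ⟨Q, oQ, V, oV, h1, h2, h3, h4, h5⟩ := exists_chain_lexSum hP hS
      exact ⟨Q, oQ, V, oV, h1, h2, h3, h4, Or.inl h5⟩
    by_cases hpar : ∃ S : Set P, IsParallelCut S
    · obtain ⟨S, hS⟩ := hpar
      obtain ⟨Q, oQ, V, oV, h1, h2, h3, h4, h5⟩ := exists_antichain_lexSum hP hS
      exact ⟨Q, oQ, V, oV, h1, h2, h3, h4, Or.inr (Or.inl h5)⟩
    · obtain ⟨Q, oQ, V, oV, h1, h2, h3, h4, h5⟩ :=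
        exists_prime_lexSum hP (not_exists.1 hser) (not_exists.1 hpar)
      exact ⟨Q, oQ, V, oV, h1, h2, h3, h4, Or.inr (Or.inr h5)⟩
  · rintro ⟨Q, oQ, V, oV, -, -, hV, ⟨e⟩, hQ⟩
    refine IsIOFin.of_orderEmbedding e.toOrderEmbedding ?_
    rcases hQ with hQ | ⟨hQ, hone⟩ | ⟨hQ, hFin, hna, hs⟩
    · exact isIOFin_lexSum_of_chain hV hQ
    · exact isIOFin_lexSum_of_antichain hV hQ hone
    · exact isIOFin_lexSum_of_prime hV hQ hFin hna hs
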